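/- Let $d\ge 1$ and $1<p<\infty$. Let $(\{X\},\{Y\},T)$ be a random triple, defined on a probability space, where $\{X\},\{Y\}\subset\mathbb{R}^d$ are independent Poisson point processes of unit intensity (random locally finite point sets) and $T$ is a (random) bijection from $\{X\}$ onto $\{Y\}$, measurable in the sense that the numbers \[ N_{U,V}:=\#\{(X,Y)\in U\times V \,:\, Y=T(X)\} \] of matched pairs are measurable for all Borel sets $U,V\subset\mathbb{R}^d$. Assume that almost surely $T$ is $p$-cyclically monotone, i.e. for every $n\in\mathbb{N}$, all points $X_1,\dots,X_n\in\{X\}$ and every permutation $\sigma$ of $\{1,\dots,n\}$, \[ \sum_{i=1}^n |T(X_i)-X_i|^p\le\sum_{i=1}^n |T(X_{\sigma(i)})-X_i|^p . \] Assume moreover that the law of $(\{X\},\{Y\},T)$ on the $\sigma$-algebra generated by the $N_{U,V}$ is invariant (stationarity) and ergodic under the action of $\mathbb{Z}^d$ given by \[ (\{X\},\{Y\},T)\mapsto(\{\bar x+X\},\{\bar x+Y\},T(\cdot-\bar x)+\bar x),\qquad \bar x\in\mathbb{Z}^d . \] Then for every $\varepsilon>0$ there exists a random radius $r_*$ (a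 random variable), finite almost surely, such that almost surely, for every $R\ge r_*$ and every point $X\in\{X\}$ with $X\in(-R,R)^d$, \[ |T(X)-X|\le\varepsilon R . \] -/

import Mathlib

open MeasureTheory ProbabilityTheory

namespace PoissonMatching

/-- The Euclidean space `ℝ^d`. -/
abbrev Space (d : ℕ) : Type := EuclideanSpace ℝ (Fin d)

/-- A lattice vector, seen as a vector of `ℝ^d`. -/
def latticeVec {d : ℕ} (z : Fin d → ℤ) : Space d :=
  WithLp.toLp 2 fun i => (z i : ℝ)

/-- Locally finite subsets of `ℝ^d`. -/
structure PointSet (d : ℕ) where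
  carrier : Set (Space d)
  locallyFinite : ∀ B : Set (Space d), Bornology.IsBounded B → (carrier ∩ B).Finite

/-- The number of points of `S` in `B`. -/
noncomputable def PointSet.count {d : ℕ} (S : PointSet d) (B : Set (Space d)) : ℕ∞ :=
  (S.carrier ∩ B).encard

/-- The σ-algebra on locally finite point sets generated by the numbers of points in Borel sets. -/
noncomputable instance {d : ℕ} : MeasurableSpace (PointSet d) :=
  ⨆ (B : Set (Space d)) (_ : MeasurableSet B),
    MeasurableSpace.comap (fun S : PointSet d => S.count B) inferInstance

/-- The translate `v + S` of a locally finite set. -/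
def PointSet.translate {d : ℕ} (v : Space d) (S : PointSet d) : PointSet d where
  carrier := {x | x - v ∈ S.carrier}
  locallyFinite := fun B hB => by
    have hB' : Bornology.IsBounded ((fun x : Space d => x - v) '' B) := by
      obtain ⟨C, hC⟩ := hB.exists_norm_le
      refine isBounded_iff_forall_norm_le.2 ⟨C + ‖v‖, ?_⟩
      rintro _ ⟨x, hx, rfl⟩
      exact (norm_sub_le x v).trans (by linarith [hC x hx])
    refine Set.Finite.of_finite_image ((S.locallyFinite _ hB').subset ?_)
      (sub_left_injective (b := v)).injOn
    rintro _ ⟨x, ⟨hx, hxB⟩, rfl⟩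
    exact ⟨hx, x, hxB, rfl⟩

/-- A triple `({X}, {Y}, T)`: two locally finite point sets and a bijection from the first onto
the second. Only the values of `T` on `{X}` matter. -/
structure Matching (d : ℕ) where
  X : PointSet d
  Y : PointSet d
  T : Space d → Space d
  bijOn : Set.BijOn T X.carrier Y.carrier

/-- `N_{U,V}`, the number of matched pairs in `U × V`. -/
noncomputable def Matching.pairCount {d : ℕ} (M : Matching d) (U V : Set (Space d)) : ℕ∞ :=
  {q : Space d × Space d | q.1 ∈ M.X.carrier ∧ q.2 = M.T q.1 ∧ q.1 ∈ U ∧ q.2 ∈ V}.encard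

/-- The σ-algebra on triples generated by the numbers `N_{U,V}` for Borel sets `U`, `V`. -/
noncomputable instance {d : ℕ} : MeasurableSpace (Matching d) :=
  ⨆ (U : Set (Space d)) (V : Set (Space d)) (_ : MeasurableSet U) (_ : MeasurableSet V),
    MeasurableSpace.comap (fun M : Matching d => M.pairCount U V) inferInstance

/-- The action of `ℤ^d` on triples,
`({X}, {Y}, T) ↦ ({z + X}, {z + Y}, T(· - z) + z)`. -/
noncomputable instance {d : ℕ} : VAdd (Fin d → ℤ) (Matching d) where
  vadd z M :=
    { X := M.X.translate (latticeVec z)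
      Y := M.Y.translate (latticeVec z)
      T := fun x => M.T (x - latticeVec z) + latticeVec z
      bijOn := by
        refine ⟨fun x hx => ?_, fun x hx y hy h => ?_, fun y hy => ?_⟩
        · have h := M.bijOn.mapsTo hx
          simpa [PointSet.translate] using h
        · exact sub_left_injective (M.bijOn.injOn hx hy (add_right_cancel h))
        · obtain ⟨x, hx, hxy⟩ := M.bijOn.surjOn hy
          refine ⟨x + latticeVec z, ?_, ?_⟩
          · simpa [PointSet.translate] using hx
          · simp [hxy] }

/-- A random point set is a Poisson point process of unit intensity: the number of points in a
Borel set `B` of finite volume is Poisson distributed with parameter `|B|`, and the numbers of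
points in finitely many pairwise disjoint Borel sets are independent. -/
structure IsPoissonProcess {d : ℕ} {Ω : Type*} [MeasurableSpace Ω] (S : Ω → PointSet d)
    (P : Measure Ω) : Prop where
  measurable : Measurable S
  map_count : ∀ B : Set (Space d), MeasurableSet B → volume B ≠ ⊤ →
    P.map (fun ω => (S ω).count B)
      = (poissonMeasure (volume B).toNNReal).map (fun n : ℕ => (n : ℕ∞))
  iIndepFun_count : ∀ (n : ℕ) (B : Fin n → Set (Space d)), (∀ i, MeasurableSet (B i)) →
    Pairwise (fun i j => Disjoint (B i) (B j)) →
    iIndepFun (fun i ω => (S ω).count (B i)) P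

/-- `T` is `p`-cyclically monotone on `{X}`: on finitely many points, no permutation of the
images lowers the sum of the `p`-th powers of the distances. -/
def Matching.IsCyclicallyMonotone {d : ℕ} (p : ℝ) (M : Matching d) : Prop :=
  ∀ (n : ℕ) (x : Fin n → Space d), (∀ i, x i ∈ M.X.carrier) → ∀ σ : Equiv.Perm (Fin n),
    ∑ i, ‖M.T (x i) - x i‖ ^ p ≤ ∑ i, ‖M.T (x (σ i)) - x i‖ ^ p

end PoissonMatching

namespace PoissonMatching

/-- The lattice points at sup-distance at most `k` from `z`. -/
noncomputable def latticeBox {d : ℕ} (z : Fin d → ℤ) (k : ℕ) : Finset (Fin d → ℤ) :=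
  Finset.Icc (fun i => z i - k) (fun i => z i + k)

theorem mem_latticeBox {d : ℕ} {z w : Fin d → ℤ} {k : ℕ} :
    w ∈ latticeBox z k ↔ ∀ i, |w i - z i| ≤ k := by
  simp only [latticeBox, Finset.mem_Icc, Pi.le_def, ← forall_and, abs_le]
  exact forall_congr' fun i => ⟨fun h => ⟨by linarith [h.1], by linarith [h.2]⟩,
    fun h => ⟨by linarith [h.1], by linarith [h.2]⟩⟩

theorem card_latticeBox {d : ℕ} (z : Fin d → ℤ) (k : ℕ) :
    (latticeBox z k).card = (2 * k + 1) ^ d := by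
  have h : ∀ i : Fin d, (z i + k + 1 - (z i - k)).toNat = 2 * k + 1 := fun i => by omega
  simp [latticeBox, Pi.card_Icc, h]

theorem mem_latticeBox_iff_mem_closedBall {d : ℕ} {z w : Fin d → ℤ} {k : ℕ} :
    w ∈ latticeBox z k ↔ w ∈ Metric.closedBall z (k : ℝ) := by
  rw [mem_latticeBox, Metric.mem_closedBall, dist_pi_le_iff (Nat.cast_nonneg k)]
  refine forall_congr' fun i => ?_
  rw [Int.dist_eq]
  exact_mod_cast Iff.rfl

open Classical in
/-- The Hardy–Littlewood covering estimate for counting measure on `ℤ^d`. -/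
theorem card_le_of_dense {d : ℕ} (A : Set (Fin d → ℤ)) (m N K : ℕ)
    (S : Finset (Fin d → ℤ)) (hS : S ⊆ latticeBox 0 N)
    (h : ∀ z ∈ S, ∃ k ≤ K, (2 * k + 1) ^ d ≤ m * ((latticeBox z k).filter (· ∈ A)).card) :
    S.card ≤ 5 ^ d * m * ((latticeBox 0 (N + K)).filter (· ∈ A)).card := by
  choose! k hkK hk using h
  obtain ⟨u, huS, hdisj, hcov⟩ :=
    Vitali.exists_disjoint_subfamily_covering_enlargement_closedBall (S : Set (Fin d → ℤ)) id
      (fun z => (k z : ℝ)) K (fun z hz => by exact_mod_cast hkK z hz) 5 (by norm_num)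
  have hufin : u.Finite := S.finite_toSet.subset huS
  lift u to Finset (Fin d → ℤ) using hufin
  have hcover : S ⊆ u.biUnion fun b => latticeBox b (5 * k b) := by
    intro z hz
    obtain ⟨b, hb, hzb⟩ := hcov z hz
    refine Finset.mem_biUnion.2 ⟨b, hb, mem_latticeBox_iff_mem_closedBall.2 ?_⟩
    have := hzb (Metric.mem_closedBall_self (Nat.cast_nonneg _))
    simpa using this
  have hpd : (u : Set (Fin d → ℤ)).PairwiseDisjoint
      fun b => (latticeBox b (k b)).filter (· ∈ A) := by
    intro b hb c hc hbc
    refine Finset.disjoint_left.2 fun w hwb hwc => ?_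
    exact Set.disjoint_left.1 (hdisj hb hc hbc)
      (mem_latticeBox_iff_mem_closedBall.1 (Finset.mem_filter.1 hwb).1)
      (mem_latticeBox_iff_mem_closedBall.1 (Finset.mem_filter.1 hwc).1)
  have hsub : (u.biUnion fun b => (latticeBox b (k b)).filter (· ∈ A)) ⊆
      (latticeBox 0 (N + K)).filter (· ∈ A) := by
    intro w hw
    obtain ⟨b, hb, hwb⟩ := Finset.mem_biUnion.1 hw
    rw [Finset.mem_filter] at hwb ⊢
    refine ⟨mem_latticeBox.2 fun i => ?_, hwb.2⟩
    have h1 := mem_latticeBox.1 hwb.1 i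
    have h2 := mem_latticeBox.1 (hS (huS hb)) i
    have h3 := hkK b (huS hb)
    simp only [Pi.zero_apply, sub_zero, abs_le] at *
    push_cast
    omega
  calc S.card ≤ (u.biUnion fun b => latticeBox b (5 * k b)).card := Finset.card_le_card hcover
    _ ≤ ∑ b ∈ u, (latticeBox b (5 * k b)).card := Finset.card_biUnion_le
    _ ≤ ∑ b ∈ u, 5 ^ d * m * ((latticeBox b (k b)).filter (· ∈ A)).card := by
        refine Finset.sum_le_sum fun b hb => ?_
        rw [card_latticeBox, mul_assoc]
        calc (2 * (5 * k b) + 1) ^ d ≤ (5 * (2 * k b + 1)) ^ d :=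
              Nat.pow_le_pow_left (by omega) d
          _ = 5 ^ d * (2 * k b + 1) ^ d := mul_pow ..
          _ ≤ _ := Nat.mul_le_mul_left _ (hk b (huS hb))
    _ = 5 ^ d * m * (u.biUnion fun b => (latticeBox b (k b)).filter (· ∈ A)).card := by
        rw [Finset.card_biUnion hpd, Finset.mul_sum]
    _ ≤ _ := Nat.mul_le_mul_left _ (Finset.card_le_card hsub)

open Classical in
/-- The event that the sites `w` with `ω ∈ H w` make up at least the fraction `1 / m` of the box of
radius `k` around `z`. -/
def denseEvent {d : ℕ} {α : Type*} (H : (Fin d → ℤ) → Set α) (m k : ℕ) (z : Fin d → ℤ) : Set α :=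
  {ω | (2 * k + 1) ^ d ≤ m * ((latticeBox z k).filter (ω ∈ H ·)).card}

open Classical in
theorem measurableSet_denseEvent {d : ℕ} {α : Type*} [MeasurableSpace α]
    {H : (Fin d → ℤ) → Set α} (hH : ∀ w, MeasurableSet (H w)) (m k : ℕ) (z : Fin d → ℤ) :
    MeasurableSet (denseEvent H m k z) := by
  have : Measurable fun ω => ((latticeBox z k).filter (ω ∈ H ·)).card := by
    simp only [Finset.card_filter]
    exact Finset.measurable_sum _ fun w _ => Measurable.ite (hH w) measurable_const measurable_const
  exact measurableSet_le measurable_const (measurable_const.mul this)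

theorem vadd_mem_denseEvent {d : ℕ} {α : Type*} [VAdd (Fin d → ℤ) α] {H : (Fin d → ℤ) → Set α}
    (hshift : ∀ (z w : Fin d → ℤ) (ω : α), z +ᵥ ω ∈ H w ↔ ω ∈ H (w - z)) (m k : ℕ)
    (z w : Fin d → ℤ) (ω : α) :
    z +ᵥ ω ∈ denseEvent H m k w ↔ ω ∈ denseEvent H m k (w - z) := by
  classical
  have : ((latticeBox w k).filter (z +ᵥ ω ∈ H ·)).card
      = ((latticeBox (w - z) k).filter (ω ∈ H ·)).card := by
    refine Finset.card_bij' (fun v _ => v - z) (fun v _ => v + z) ?_ ?_ ?_ ?_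
    · intro v hv
      simpa [mem_latticeBox, hshift] using hv
    · intro v hv
      simpa [mem_latticeBox, hshift, sub_sub_eq_add_sub] using hv
    · intro v _
      simp
    · intro v _
      simp
  simp only [denseEvent, Set.mem_ofPred_eq]
  convert Iff.rfl using 3
  convert this.symm

/-- The maximal inequality for a stationary family of events indexed by `ℤ^d`. -/
theorem measure_iUnion_denseEvent_le {d : ℕ} {α : Type*} [MeasurableSpace α]
    [VAdd (Fin d → ℤ) α] (μ : Measure α) [VAddInvariantMeasure (Fin d → ℤ) α μ]
    {H : (Fin d → ℤ) → Set α} (hH : ∀ w, MeasurableSet (H w))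
    (hshift : ∀ (z w : Fin d → ℤ) (ω : α), z +ᵥ ω ∈ H w ↔ ω ∈ H (w - z)) (m : ℕ) :
    μ (⋃ k, denseEvent H m k 0) ≤ 10 ^ d * m * μ (H 0) := by
  classical
  have hHw : ∀ w, μ (H w) = μ (H 0) := fun w => by
    refine Eq.trans (congrArg μ (Set.ext fun ω => ?_))
      (VAddInvariantMeasure.measure_preimage_vadd (-w) (hH 0))
    simp [hshift]
  set E : ℕ → (Fin d → ℤ) → Set α := fun K z => ⋃ k ∈ Finset.range (K + 1), denseEvent H m k z
    with hE
  have hEm : ∀ K z, MeasurableSet (E K z) := fun K z =>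
    Finset.measurableSet_biUnion _ fun k _ => measurableSet_denseEvent hH m k z
  have hEz : ∀ K z, μ (E K z) = μ (E K 0) := fun K z => by
    refine Eq.trans (congrArg μ (Set.ext fun ω => ?_))
      (VAddInvariantMeasure.measure_preimage_vadd (-z) (hEm K 0))
    simp only [hE, Set.mem_iUnion, Set.mem_preimage, vadd_mem_denseEvent hshift, zero_sub, neg_neg]
  have key : ∀ K, μ (E K 0) ≤ 10 ^ d * m * μ (H 0) := by
    intro K
    have hpt : ∀ ω, ((latticeBox 0 K).filter (ω ∈ E K ·)).card
        ≤ 5 ^ d * m * ((latticeBox 0 (K + K)).filter (ω ∈ H ·)).card := fun ω => by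
      refine card_le_of_dense {w | ω ∈ H w} m K K _ (Finset.filter_subset _ _) fun z hz => ?_
      obtain ⟨k, hk, hz⟩ := Set.mem_iUnion₂.1 (Finset.mem_filter.1 hz).2
      exact ⟨k, by simpa [Nat.lt_succ_iff] using hk, hz⟩
    have hint : ∀ (F : (Fin d → ℤ) → Set α) (_ : ∀ z, MeasurableSet (F z)) (N : ℕ),
        ∫⁻ ω, (((latticeBox 0 N).filter (ω ∈ F ·)).card : ENNReal) ∂μ
          = ∑ z ∈ latticeBox 0 N, μ (F z) := by
      intro F hF N
      have : ∀ ω, (((latticeBox 0 N).filter (ω ∈ F ·)).card : ENNReal)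
          = ∑ z ∈ latticeBox 0 N, (F z).indicator 1 ω := fun ω => by
        rw [Finset.card_filter]; push_cast
        exact Finset.sum_congr rfl fun z _ => by simp [Set.indicator_apply]
      simp_rw [this]
      rw [lintegral_finsetSum _ fun z _ => measurable_one.indicator (hF z)]
      exact Finset.sum_congr rfl fun z _ => lintegral_indicator_one (hF z)
    have h1 : ((2 * K + 1) ^ d : ENNReal) * μ (E K 0)
        ≤ (2 * K + 1) ^ d * (10 ^ d * m * μ (H 0)) := by
      calc ((2 * K + 1) ^ d : ENNReal) * μ (E K 0)
          = ∑ z ∈ latticeBox 0 K, μ (E K z) := by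
            simp [hEz, card_latticeBox]
        _ = ∫⁻ ω, (((latticeBox 0 K).filter (ω ∈ E K ·)).card : ENNReal) ∂μ :=
            (hint _ (hEm K) K).symm
        _ ≤ ∫⁻ ω, 5 ^ d * m * (((latticeBox 0 (K + K)).filter (ω ∈ H ·)).card : ENNReal) ∂μ :=
            lintegral_mono fun ω => by
              have := Nat.cast_le (α := ENNReal).2 (hpt ω)
              push_cast at this
              exact this
        _ = 5 ^ d * m * ∑ z ∈ latticeBox 0 (K + K), μ (H z) := by
            rw [lintegral_const_mul', hint H hH]
            exact_mod_cast ENNReal.natCast_ne_top (5 ^ d * m)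
        _ = 5 ^ d * m * ((2 * (K + K) + 1) ^ d * μ (H 0)) := by
            simp [hHw, card_latticeBox]
        _ ≤ 5 ^ d * m * ((2 * (2 * K + 1)) ^ d * μ (H 0)) := by
            gcongr
            exact_mod_cast (by omega : 2 * (K + K) + 1 ≤ 2 * (2 * K + 1))
        _ = _ := by
            rw [mul_pow, show (10 : ENNReal) = 5 * 2 by norm_num, mul_pow]; ring
    refine (ENNReal.mul_le_mul_iff_right ?_ ?_).1 h1
    · exact_mod_cast (pow_pos (Nat.succ_pos (2 * K)) d).ne'
    · exact_mod_cast ENNReal.natCast_ne_top ((2 * K + 1) ^ d)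
  have hmono : Monotone fun K => E K 0 := fun a b hab =>
    Set.biUnion_subset_biUnion_left fun k hk =>
      Finset.mem_range.2 ((Finset.mem_range.1 hk).trans_le (by omega))
  calc μ (⋃ k, denseEvent H m k 0) ≤ μ (⋃ K, E K 0) := by
        refine measure_mono (Set.iUnion_mono fun k ω hω => ?_)
        exact Set.mem_iUnion₂.2 ⟨k, by simp, hω⟩
    _ = ⨆ K, μ (E K 0) := hmono.measure_iUnion
    _ ≤ _ := iSup_le key

/-- Replacing a jump of length `D` by one jump of length about `s` and one of length about `D - s`
lowers the cost, if `s` is small compared to `D`. -/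
theorem exists_jump_fraction {p : ℝ} (hp : 1 < p) :
    ∃ t : ℝ, 0 < t ∧ t ≤ 1 / 2 ∧ ∀ D s : ℝ, 0 < s → s ≤ t * D →
      (3 / 2 * s) ^ p + (D - s / 2) ^ p < D ^ p := by
  have hp1 : 0 < p - 1 := by linarith
  have hlim : Filter.Tendsto (fun t : ℝ => (3 / 2 * t) ^ (p - 1)) (nhdsWithin 0 (Set.Ioi 0))
      (nhds 0) := by
    have : ContinuousAt (fun t : ℝ => (3 / 2 * t) ^ (p - 1)) 0 :=
      (continuousAt_const.mul continuousAt_id).rpow_const (Or.inr hp1.le)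
    have h0 := this.tendsto
    simp only [mul_zero, Real.zero_rpow hp1.ne'] at h0
    exact h0.mono_left nhdsWithin_le_nhds
  obtain ⟨t, ht, ht0, ht1⟩ := ((hlim.eventually (gt_mem_nhds (by norm_num : (0 : ℝ) < 1 / 3))).and
    (Ioc_mem_nhdsGT (by norm_num : (0 : ℝ) < 1 / 2))).exists
  refine ⟨t, ht0, ht1, fun D s hs hsD => ?_⟩
  have hD : 0 < D := by
    by_contra! h
    nlinarith
  set u := s / D with hu
  have hu0 : 0 < u := div_pos hs hD
  have hut : u ≤ t := (div_le_iff₀ hD).2 hsD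
  have hsu : s = D * u := by rw [hu]; field_simp
  have e1 : (3 / 2 * s) ^ p = D ^ p * (3 / 2 * u) ^ p := by
    rw [← Real.mul_rpow hD.le (by positivity), hsu]; ring_nf
  have e2 : (D - s / 2) ^ p = D ^ p * (1 - u / 2) ^ p := by
    rw [← Real.mul_rpow hD.le (by linarith), hsu]; ring_nf
  have b1 : (3 / 2 * u) ^ p < u / 2 := by
    have : (3 / 2 * u) ^ p = (3 / 2 * u) ^ (p - 1) * (3 / 2 * u) := by
      rw [← Real.rpow_add_one (by positivity)]; ring_nf
    rw [this]
    have : (3 / 2 * u) ^ (p - 1) < 1 / 3 :=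
      (Real.rpow_le_rpow (by positivity) (by linarith) hp1.le).trans_lt ht
    nlinarith
  have b2 : (1 - u / 2) ^ p ≤ 1 - u / 2 :=
    Real.rpow_le_self_of_le_one (by linarith) (by linarith) hp.le
  rw [e1, e2, ← mul_add]
  have : 0 < D ^ p := Real.rpow_pos_of_pos hD p
  nlinarith

theorem Matching.IsCyclicallyMonotone.pair {d : ℕ} {p : ℝ} {M : Matching d}
    (h : M.IsCyclicallyMonotone p) {x y : Space d} (hx : x ∈ M.X.carrier) (hy : y ∈ M.X.carrier) :
    ‖M.T x - x‖ ^ p + ‖M.T y - y‖ ^ p ≤ ‖M.T y - x‖ ^ p + ‖M.T x - y‖ ^ p := by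
  have := h 2 ![x, y] (by simp [Fin.forall_fin_two, hx, hy]) (Equiv.swap 0 1)
  simpa [Fin.sum_univ_two] using this

/-- No matched pair lies close to an intermediate point of a long jump. -/
theorem not_nearby_pair_of_long_jump {d : ℕ} {p t s D : ℝ} {M : Matching d} (hp : 0 < p)
    (h : M.IsCyclicallyMonotone p)
    (ht : ∀ D s : ℝ, 0 < s → s ≤ t * D → (3 / 2 * s) ^ p + (D - s / 2) ^ p < D ^ p)
    {x y : Space d} (hx : x ∈ M.X.carrier) (hy : y ∈ M.X.carrier) (ht1 : t ≤ 1 / 2)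
    (hD : D = ‖M.T x - x‖) (hs : 0 < s) (hsD : s ≤ t * D)
    (h1 : ‖y - (x + (s / D) • (M.T x - x))‖ ≤ s / 2)
    (h2 : ‖M.T y - (x + (s / D) • (M.T x - x))‖ ≤ s / 2) : False := by
  have hD0 : 0 < D := by
    have : 0 ≤ D := hD ▸ norm_nonneg _
    rcases this.eq_or_lt with h | h
    · rw [← h] at hsD; linarith
    · exact h
  have hsD' : s ≤ D := by nlinarith
  have e1 : ‖(s / D) • (M.T x - x)‖ = s := by
    rw [norm_smul, ← hD, Real.norm_of_nonneg (by positivity)]; field_simp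
  have e2 : ‖(1 - s / D) • (M.T x - x)‖ = D - s := by
    rw [norm_smul, ← hD, Real.norm_of_nonneg (by rw [sub_nonneg, div_le_one hD0]; exact hsD')]
    field_simp
  have a1 : ‖M.T y - x‖ ≤ 3 / 2 * s := by
    have : M.T y - x = (M.T y - (x + (s / D) • (M.T x - x))) + (s / D) • (M.T x - x) := by abel
    rw [this]
    exact (norm_add_le _ _).trans (by linarith)
  have a2 : ‖M.T x - y‖ ≤ D - s / 2 := by
    have : M.T x - y = (1 - s / D) • (M.T x - x) - (y - (x + (s / D) • (M.T x - x))) := by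
      rw [sub_smul, one_smul]; abel
    rw [this]
    exact (norm_sub_le _ _).trans (by linarith)
  have := h.pair hx hy
  have b1 := Real.rpow_le_rpow (norm_nonneg _) a1 hp.le
  have b2 := Real.rpow_le_rpow (norm_nonneg _) a2 hp.le
  have b3 := Real.rpow_nonneg (norm_nonneg (M.T y - y)) p
  have b4 := ht D s hs hsD
  rw [← hD] at this
  linarith

theorem norm_le_of_forall_abs_le {d : ℕ} (v : Space d) {b : ℝ} (h : ∀ i, |v i| ≤ b) :
    ‖v‖ ≤ d * b := by
  calc ‖v‖ = ‖∑ i, v i • EuclideanSpace.single i (1 : ℝ)‖ := by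
        congr 1; ext j; simp [Finset.sum_apply, Pi.single_apply]
    _ ≤ ∑ i : Fin d, ‖v i • EuclideanSpace.single i (1 : ℝ)‖ := norm_sum_le _ _
    _ ≤ ∑ _i : Fin d, b := Finset.sum_le_sum fun i _ => by simpa [norm_smul] using h i
    _ = d * b := by simp

/-- The event that no pair is matched within the ball of radius `a` around the site `w`. -/
def noPairEvent (d a : ℕ) (w : Fin d → ℤ) : Set (Matching d) :=
  {M | M.pairCount (Metric.ball (latticeVec w) a) (Metric.ball (latticeVec w) a) = 0}

theorem notMem_noPairEvent {d a : ℕ} {w : Fin d → ℤ} {M : Matching d} :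
    M ∉ noPairEvent d a w ↔
      ∃ y ∈ M.X.carrier, ‖y - latticeVec w‖ < a ∧ ‖M.T y - latticeVec w‖ < a := by
  simp only [noPairEvent, Matching.pairCount, Set.mem_ofPred_eq, Set.encard_eq_zero, ← ne_eq,
    ← Set.nonempty_iff_ne_empty, mem_ball_iff_norm]
  constructor
  · rintro ⟨⟨y, y'⟩, hy, h, h1, h2⟩
    simp only at hy h h1 h2
    exact ⟨y, hy, h1, h ▸ h2⟩
  · rintro ⟨y, hy, h1, h2⟩
    exact ⟨(y, M.T y), hy, rfl, h1, h2⟩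

theorem measurableSet_noPairEvent (d a : ℕ) (w : Fin d → ℤ) :
    MeasurableSet (noPairEvent d a w) := by
  have : Measurable fun M : Matching d =>
      M.pairCount (Metric.ball (latticeVec w) a) (Metric.ball (latticeVec w) a) := by
    refine Measurable.of_comap_le ?_
    refine le_iSup_of_le (Metric.ball (latticeVec w) a) <|
      le_iSup_of_le (Metric.ball (latticeVec w) a) <|
      le_iSup_of_le measurableSet_ball <| le_iSup_of_le measurableSet_ball le_rfl
  exact this (measurableSet_singleton 0)

theorem vadd_mem_noPairEvent {d a : ℕ} (z w : Fin d → ℤ) (M : Matching d) :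
    z +ᵥ M ∈ noPairEvent d a w ↔ M ∈ noPairEvent d a (w - z) := by
  have hl : latticeVec (w - z) = latticeVec w - latticeVec z := by
    ext i; simp [latticeVec]
  rw [← not_iff_not, notMem_noPairEvent, notMem_noPairEvent, hl]
  constructor
  · rintro ⟨y, hy, h1, h2⟩
    refine ⟨y - latticeVec z, hy, ?_, ?_⟩
    · rwa [sub_sub_sub_cancel_right]
    · rwa [sub_sub_eq_add_sub]
  · rintro ⟨y, hy, h1, h2⟩
    refine ⟨y + latticeVec z, ?_, ?_, ?_⟩
    · change y + latticeVec z - latticeVec z ∈ M.X.carrier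
      simpa using hy
    · rwa [← sub_sub_eq_add_sub]
    · change ‖M.T (y + latticeVec z - latticeVec z) + latticeVec z - latticeVec w‖ < a
      rwa [add_sub_cancel_right, ← sub_sub_eq_add_sub]

/-- If sites without a matched pair nearby are sparse at all scales, then displacements grow at most
like `ε R`. -/
theorem exists_displacement_bound {d : ℕ} (hd : 0 < d) {p : ℝ} (hp : 1 < p) {ε : ℝ} (hε : 0 < ε) :
    ∃ (m : ℕ) (r : ℕ → ℝ), ∀ (a : ℕ) (M : Matching d), M.IsCyclicallyMonotone p →
      M ∉ ⋃ k, denseEvent (noPairEvent d a) m k 0 → ∀ R : ℝ, r a ≤ R →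
        ∀ x ∈ M.X.carrier, (∀ i, x i ∈ Set.Ioo (-R) R) → ‖M.T x - x‖ ≤ ε * R := by
  classical
  obtain ⟨t, ht0, ht1, ht⟩ := exists_jump_fraction hp
  set κ := t * min ε 1 with hκ
  have hκ0 : 0 < κ := mul_pos ht0 (lt_min hε one_pos)
  have hκ1 : κ ≤ 1 := by
    have : min ε 1 ≤ 1 := min_le_right _ _
    nlinarith
  have hκε : κ ≤ t * ε := mul_le_mul_of_nonneg_left (min_le_left _ _) ht0.le
  have hd0 : (0 : ℝ) < d := by exact_mod_cast hd
  set c := κ / (4 * d) with hc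
  have hc0 : 0 < c := by positivity
  have hcκ : d * c = κ / 4 := by rw [hc]; field_simp
  set C := ⌈8 / c⌉₊ + 1 with hC
  have hC8 : 8 / c ≤ C - 1 := by rw [hC]; push_cast; linarith [Nat.le_ceil (8 / c)]
  refine ⟨C ^ d, fun a => max (max 1 (1 / c)) (4 * (d + a) / κ),
    fun a M hM hdense R hR x hx hxR => ?_⟩
  by_contra! hlong
  have hR1 : 1 ≤ R := (le_max_left _ _).trans ((le_max_left _ _).trans hR)
  have hRc : 1 ≤ c * R := by
    have : 1 / c ≤ R := (le_max_right _ _).trans ((le_max_left _ _).trans hR)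
    rwa [div_le_iff₀ hc0, mul_comm] at this
  have hRa : 4 * (d + a) ≤ κ * R := by
    have : 4 * (d + a) / κ ≤ R := (le_max_right _ _).trans hR
    rwa [div_le_iff₀ hκ0, mul_comm R] at this
  set D := ‖M.T x - x‖ with hD
  set s := κ * R with hs
  have hs0 : 0 < s := by positivity
  have hD0 : 0 < D := lt_of_le_of_lt (by positivity) hlong
  have hsD : s ≤ t * D := by
    calc s ≤ t * ε * R := mul_le_mul_of_nonneg_right hκε (by linarith)
      _ = t * (ε * R) := by ring
      _ ≤ t * D := by gcongr
  set q := x + (s / D) • (M.T x - x) with hq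
  have hqi : ∀ i, |q i| ≤ 2 * R := fun i => by
    have e : ‖(s / D) • (M.T x - x)‖ = s := by
      rw [norm_smul, ← hD, Real.norm_of_nonneg (by positivity)]; field_simp
    have h1 : |((s / D) • (M.T x - x)) i| ≤ s := by
      rw [← Real.norm_eq_abs]; exact (PiLp.norm_apply_le _ i).trans e.le
    have h2 : |x i| ≤ R := abs_le.2 ⟨(hxR i).1.le, (hxR i).2.le⟩
    have h3 : s ≤ R := by rw [hs]; nlinarith
    have h4 : q i = x i + ((s / D) • (M.T x - x)) i := by rw [hq]; simp
    rw [h4]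
    exact (abs_add_le _ _).trans (by linarith)
  set j := ⌊c * R⌋₊ with hj
  have hj1 : (j : ℝ) ≤ c * R := Nat.floor_le (by linarith)
  have hj2 : c * R < j + 1 := Nat.lt_floor_add_one _
  set k := ⌈2 * R⌉₊ + 1 + j with hk
  set z : Fin d → ℤ := fun i => ⌊q i⌋ with hz
  have hsub : latticeBox z j ⊆ latticeBox 0 k := by
    intro w hw
    rw [mem_latticeBox] at hw ⊢
    intro i
    have h1 : |(z i : ℝ)| ≤ ⌈2 * R⌉₊ + 1 := by
      have := abs_le.1 (hqi i)
      have h2 := Nat.le_ceil (2 * R)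
      have h3 := Int.floor_le (q i)
      have h4 := Int.lt_floor_add_one (q i)
      rw [abs_le]
      constructor <;> simp only [hz] <;> linarith
    have h1' : |z i| ≤ ⌈2 * R⌉₊ + 1 := by exact_mod_cast h1
    have h2 := hw i
    simp only [Pi.zero_apply, sub_zero, abs_le] at *
    rw [hk]; push_cast
    omega
  have hkj : 2 * k + 1 ≤ C * (2 * j + 1) := by
    have h1 : (⌈2 * R⌉₊ : ℝ) < 2 * R + 1 := Nat.ceil_lt_add_one (by linarith)
    have h2 : 8 * R ≤ 8 / c * (2 * j + 1) := by
      rw [div_mul_eq_mul_div, le_div_iff₀ hc0]; linarith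
    have h3 : 8 / c * (2 * j + 1) ≤ (C - 1) * (2 * j + 1 : ℝ) := by gcongr
    have : (2 * k + 1 : ℝ) ≤ C * (2 * j + 1) := by
      rw [hk]; push_cast; linarith
    exact_mod_cast this
  obtain ⟨w, hw, hwH⟩ : ∃ w ∈ latticeBox z j, M ∉ noPairEvent d a w := by
    by_contra! hall
    refine hdense (Set.mem_iUnion.2 ⟨k, ?_⟩)
    change (2 * k + 1) ^ d ≤ C ^ d * ((latticeBox 0 k).filter (M ∈ noPairEvent d a ·)).card
    calc (2 * k + 1) ^ d ≤ (C * (2 * j + 1)) ^ d := Nat.pow_le_pow_left hkj d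
      _ = C ^ d * (latticeBox z j).card := by rw [card_latticeBox, mul_pow]
      _ ≤ _ := Nat.mul_le_mul_left _ (Finset.card_le_card fun w hw =>
          Finset.mem_filter.2 ⟨hsub hw, hall w hw⟩)
  obtain ⟨y, hy, hy1, hy2⟩ := notMem_noPairEvent.1 hwH
  have hwq : ‖latticeVec w - q‖ ≤ d * (j + 1) := by
    refine norm_le_of_forall_abs_le _ fun i => ?_
    have h1 : |(w i : ℝ) - z i| ≤ j := by exact_mod_cast mem_latticeBox.1 hw i
    have h3 := Int.floor_le (q i)
    have h4 := Int.lt_floor_add_one (q i)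
    have h5 : (latticeVec w - q) i = w i - q i := by simp [latticeVec]
    rw [h5]
    simp only [hz, abs_le] at h1 ⊢
    constructor <;> linarith
  have hrad : d * (j + 1) + a ≤ s / 2 := by
    have : d * (j : ℝ) ≤ s / 4 := by
      calc d * (j : ℝ) ≤ d * (c * R) := by gcongr
        _ = s / 4 := by rw [← mul_assoc, hcκ, hs]; ring
    linarith
  have near : ∀ v : Space d, ‖v - latticeVec w‖ < a → ‖v - q‖ ≤ s / 2 := fun v hv => by
    have := norm_add_le (v - latticeVec w) (latticeVec w - q)
    rw [sub_add_sub_cancel] at this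
    linarith
  exact not_nearby_pair_of_long_jump (by linarith) hM ht hx hy ht1 hD hs0 hsD (near y hy1)
    (near _ hy2)

/-- A Poisson process is almost surely nonempty. -/
theorem IsPoissonProcess.measure_carrier_eq_empty {d : ℕ} (hd : 0 < d) {Ω : Type*}
    [MeasurableSpace Ω] {P : Measure Ω} {S : Ω → PointSet d} (h : IsPoissonProcess S P) :
    P {ω | (S ω).carrier = ∅} = 0 := by
  have : Nonempty (Fin d) := ⟨⟨0, hd⟩⟩
  have hvoid : ∀ n : ℕ, P {ω | (S ω).carrier = ∅}
      ≤ ENNReal.ofReal (Real.exp (-(volume (Metric.ball (0 : Space d) n)).toReal)) := by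
    intro n
    have hcount : Measurable fun T : PointSet d => T.count (Metric.ball (0 : Space d) n) := by
      refine Measurable.of_comap_le ?_
      refine le_iSup_of_le (Metric.ball (0 : Space d) n) ?_
      exact le_iSup_of_le measurableSet_ball le_rfl
    have hmeas : Measurable fun ω => (S ω).count (Metric.ball (0 : Space d) n) :=
      hcount.comp h.measurable
    have hlaw := congrArg (fun ν => ν {0})
      (h.map_count (Metric.ball (0 : Space d) n) measurableSet_ball measure_ball_lt_top.ne)
    rw [Measure.map_apply hmeas (measurableSet_singleton 0),
      Measure.map_apply (by fun_prop) (measurableSet_singleton 0)] at hlaw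
    have hpre : (fun n : ℕ => (n : ℕ∞)) ⁻¹' {0} = {0} := by ext n; simp
    rw [hpre, poissonMeasure_singleton] at hlaw
    calc P {ω | (S ω).carrier = ∅}
        ≤ P ((fun ω => (S ω).count (Metric.ball (0 : Space d) n)) ⁻¹' {0}) := by
          refine measure_mono fun ω hω => ?_
          have hω' : (S ω).carrier = ∅ := hω
          simp [PointSet.count, hω']
      _ = _ := by rw [hlaw]; simp [ENNReal.coe_toNNReal_eq_toReal]
  have hlim : Filter.Tendsto (fun n : ℕ => ENNReal.ofReal
      (Real.exp (-(volume (Metric.ball (0 : Space d) n)).toReal))) Filter.atTop (nhds 0) := by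
    rw [← ENNReal.ofReal_zero]
    refine ENNReal.tendsto_ofReal (Real.tendsto_exp_neg_atTop_nhds_zero.comp ?_)
    have hv : 0 < (volume (Metric.ball (0 : Space d) 1)).toReal :=
      ENNReal.toReal_pos (Metric.measure_ball_pos _ _ one_pos).ne' measure_ball_lt_top.ne
    have e : ∀ n : ℕ, (volume (Metric.ball (0 : Space d) n)).toReal
        = (n : ℝ) ^ d * (volume (Metric.ball (0 : Space d) 1)).toReal := fun n => by
      rw [Measure.addHaar_ball _ _ (Nat.cast_nonneg n), ENNReal.toReal_mul,
        ENNReal.toReal_ofReal (by positivity), finrank_euclideanSpace_fin]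
    simp_rw [e]
    exact ((Filter.tendsto_pow_atTop hd.ne').comp tendsto_natCast_atTop_atTop).atTop_mul_const hv
  exact le_antisymm (ge_of_tendsto' hlim hvoid) zero_le

/-- A matched pair is eventually seen from the origin, as soon as there are points at all. -/
theorem tendsto_measure_noPairEvent {d : ℕ} (hd : 0 < d) {Ω : Type*} [MeasurableSpace Ω]
    {P : Measure Ω} [IsProbabilityMeasure P] {M : Ω → Matching d} (hM : Measurable M)
    (hX : IsPoissonProcess (fun ω => (M ω).X) P) :
    Filter.Tendsto (fun a => P.map M (noPairEvent d a 0)) Filter.atTop (nhds 0) := by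
  have := Measure.isProbabilityMeasure_map (μ := P) hM.aemeasurable
  have hanti : Antitone fun a => noPairEvent d a 0 := by
    intro a b hab N hN
    by_contra hNa
    obtain ⟨y, hy, h1, h2⟩ := notMem_noPairEvent.1 hNa
    have : (a : ℝ) ≤ b := by exact_mod_cast hab
    exact notMem_noPairEvent.2 ⟨y, hy, h1.trans_le this, h2.trans_le this⟩ hN
  have hlim := tendsto_measure_iInter_atTop (μ := P.map M)
    (fun a => (measurableSet_noPairEvent d a 0).nullMeasurableSet) hanti ⟨0, measure_ne_top _ _⟩
  have hzero : P.map M (⋂ a, noPairEvent d a 0) = 0 := by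
    rw [Measure.map_apply hM (MeasurableSet.iInter fun a => measurableSet_noPairEvent d a 0)]
    refine measure_mono_null (fun ω hω => ?_) (hX.measure_carrier_eq_empty hd)
    by_contra hne
    obtain ⟨y, hy⟩ := Set.nonempty_iff_ne_empty.2 hne
    obtain ⟨a, ha⟩ := exists_nat_gt
      (max ‖y - latticeVec (0 : Fin d → ℤ)‖ ‖(M ω).T y - latticeVec (0 : Fin d → ℤ)‖)
    exact notMem_noPairEvent.2
      ⟨y, hy, (le_max_left _ _).trans_lt ha, (le_max_right _ _).trans_lt ha⟩ (Set.mem_iInter.1 hω a)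
  rwa [hzero] at hlim

/-- A random threshold can be chosen measurably along measurable events that almost surely
occur eventually. -/
theorem exists_measurable_threshold {Ω : Type*} [MeasurableSpace Ω] {P : Measure Ω}
    {G : ℕ → Set Ω} (hG : ∀ a, MeasurableSet (G a)) (hcov : P (⋂ a, (G a)ᶜ) = 0) (r : ℕ → ℝ) :
    ∃ ρ : Ω → ℝ, Measurable ρ ∧ ∀ᵐ ω ∂P, ∃ a, ω ∈ G a ∧ ρ ω = r a := by
  classical
  have hex : ∀ ω, ∃ a, ω ∈ G a ∨ ω ∈ ⋂ a, (G a)ᶜ := fun ω => by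
    by_cases h : ω ∈ ⋂ a, (G a)ᶜ
    · exact ⟨0, Or.inr h⟩
    · simp only [Set.mem_iInter, Set.mem_compl_iff, not_forall, not_not] at h
      exact h.imp fun a ha => Or.inl ha
  refine ⟨fun ω => r (Nat.find (hex ω)), ?_, ?_⟩
  · exact (measurable_of_countable r).comp (measurable_find hex fun a =>
      (hG a).union (MeasurableSet.iInter fun a => (hG a).compl))
  · filter_upwards [measure_eq_zero_iff_ae_notMem.1 hcov] with ω hω
    exact ⟨_, (Nat.find_spec (hex ω)).resolve_right hω, rfl⟩

end PoissonMatching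

theorem mainTheorem5 {d : ℕ} {p : ℝ} (hp : 1 < p)
    {Ω : Type*} [MeasurableSpace Ω] (P : MeasureTheory.Measure Ω)
    [MeasureTheory.IsProbabilityMeasure P]
    (M : Ω → PoissonMatching.Matching d) (hM : Measurable M)
    (hX : PoissonMatching.IsPoissonProcess (fun ω => (M ω).X) P)
    (hY : PoissonMatching.IsPoissonProcess (fun ω => (M ω).Y) P)
    (hXY : ProbabilityTheory.IndepFun (fun ω => (M ω).X) (fun ω => (M ω).Y) P)
    (herg : ErgodicVAdd (Fin d → ℤ) (PoissonMatching.Matching d) (P.map M))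
    (hcm : ∀ᵐ ω ∂P, (M ω).IsCyclicallyMonotone p)
    (ε : ℝ) (hε : 0 < ε) :
    ∃ r : Ω → ℝ, Measurable r ∧
      ∀ᵐ ω ∂P, ∀ R : ℝ, r ω ≤ R →
        ∀ x ∈ (M ω).X.carrier, (∀ i, x i ∈ Set.Ioo (-R) R) →
          ‖(M ω).T x - x‖ ≤ ε * R := by
  rcases Nat.eq_zero_or_pos d with rfl | hd
  · refine ⟨fun _ => 0, measurable_const, Filter.Eventually.of_forall fun ω R hR x _ _ => ?_⟩
    rw [Subsingleton.elim ((M ω).T x - x) 0, norm_zero]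
    positivity
  obtain ⟨m, r, hr⟩ := PoissonMatching.exists_displacement_bound hd hp hε
  set B : ℕ → Set (PoissonMatching.Matching d) := fun a =>
    ⋃ k, PoissonMatching.denseEvent (PoissonMatching.noPairEvent d a) m k 0 with hB
  have hBm : ∀ a, MeasurableSet (B a) := fun a => MeasurableSet.iUnion fun k =>
    PoissonMatching.measurableSet_denseEvent (PoissonMatching.measurableSet_noPairEvent d a) m k 0
  have hBlim : Filter.Tendsto
      (fun a => 10 ^ d * m * P.map M (PoissonMatching.noPairEvent d a 0)) Filter.atTop (nhds 0) := by
    have := ENNReal.Tendsto.const_mul (a := 10 ^ d * m)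
      (PoissonMatching.tendsto_measure_noPairEvent hd hM hX)
      (Or.inr (by exact_mod_cast ENNReal.natCast_ne_top (10 ^ d * m)))
    rwa [mul_zero] at this
  have hcov : P (⋂ a, ((M ⁻¹' B a)ᶜ)ᶜ) = 0 := by
    refine le_antisymm (ge_of_tendsto' hBlim fun a => ?_) zero_le
    calc P (⋂ a, ((M ⁻¹' B a)ᶜ)ᶜ) ≤ P (M ⁻¹' B a) := by
          refine MeasureTheory.measure_mono fun ω hω => ?_
          simpa using Set.mem_iInter.1 hω a
      _ = P.map M (B a) := (MeasureTheory.Measure.map_apply hM (hBm a)).symm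
      _ ≤ _ := PoissonMatching.measure_iUnion_denseEvent_le (P.map M)
          (PoissonMatching.measurableSet_noPairEvent d a) PoissonMatching.vadd_mem_noPairEvent m
  obtain ⟨ρ, hρ, hρG⟩ :=
    PoissonMatching.exists_measurable_threshold (fun a => (hM (hBm a)).compl) hcov r
  refine ⟨ρ, hρ, ?_⟩
  filter_upwards [hρG, hcm] with ω ⟨a, ha, hρa⟩ hω R hR
  exact hr a (M ω) hω ha R (hρa ▸ hR)
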